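/- **Definitions.** All logarithms are base 2. To a triple $(p,q,r)$ of points of the plane assign its orientation: $-1$ if $r$ lies to the left of the oriented line from $p$ to $q$, $1$ if $r$ lies to the right of it, and $0$ if $p,q,r$ are collinear. Two finite point sets have the same order type if there is a bijection between them that preserves the orientation of all triples. A drawing of a finite point set $S$ is a set of points with integer coordinates that has the same order type as $S$; the size of a drawing is the maximum of the absolute values of its coordinates. A set $X$ of points is high above a set $Y$ if every line determined by two points of $X$ is above every point of $Y$ and every line determined by two points of $Y$ is below every point of $X$. A Horton set of $2^k$ points is defined recursively: every one-point set is a Horton set of $2^0$ points; for $k\ge 1$, a set $H=\{p_0,p_1,\dots,p_{2^k-1}\}$ of $2^k$ points in the plane with pairwise distinct $x$-coordinates, indexed by increasing $x$-coordinate, is a Horton set if both $H_{\mathrm{even}}=\{p_0,p_2,\dots\}$ and $H_{\mathrm{odd}}=\{p_1,p_3,\dots\}$ are Horton sets of $2^{k-1}$ points and $H_{\mathrm{odd}}$ is high above $H_{\mathrm{even}}$. **Theorem.** There are a constant $c>0$ and an integer $N$ such that for every $n=2^k\ge N$, every drawing of a Horton set of $n$ points has size at least $$c\cdot n^{\frac{1}{24}\log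 (n/2)}.$$ -/

import Mathlib

namespace Horton

noncomputable section

/-- The orientation of a triple of points of the plane: `-1` if `r` lies to the left of the
oriented line from `p` to `q`, `1` if it lies to the right, `0` if the points are collinear. -/
def orientation (p q r : ℝ × ℝ) : SignType :=
  SignType.sign ((q.2 - p.2) * (r.1 - p.1) - (q.1 - p.1) * (r.2 - p.2))

/-- Two finite point sets have the same order type if there is a bijection between them that
preserves the orientation of all triples. -/
def SameOrderType (S T : Finset (ℝ × ℝ)) : Prop :=
  ∃ e : S ≃ T, ∀ p q r : S,
    orientation (e p : ℝ × ℝ) (e q : ℝ × ℝ) (e r : ℝ × ℝ) =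
      orientation (p : ℝ × ℝ) (q : ℝ × ℝ) (r : ℝ × ℝ)

/-- An integer point, seen as a point of the real plane. -/
def toPlane (p : ℤ × ℤ) : ℝ × ℝ := ((p.1 : ℝ), (p.2 : ℝ))

/-- A drawing of `S` is a set of points with integer coordinates and the same order type
as `S`. -/
def IsDrawing (D : Finset (ℤ × ℤ)) (S : Finset (ℝ × ℝ)) : Prop :=
  SameOrderType (D.image toPlane) S

/-- The size of a set of integer points: the maximum absolute value of its coordinates. -/
def size (D : Finset (ℤ × ℤ)) : ℕ :=
  D.sup fun p => max p.1.natAbs p.2.natAbs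

/-- The index of `p` in `S`, when `S` is sorted by `x`-coordinate and indices start at `0`:
the number of points of `S` with smaller `x`-coordinate. -/
def xIndex (S : Finset (ℝ × ℝ)) (p : ℝ × ℝ) : ℕ :=
  (S.filter fun q => q.1 < p.1).card

/-- The points of `S` of even index in the order by `x`-coordinate. -/
def evenPart (S : Finset (ℝ × ℝ)) : Finset (ℝ × ℝ) :=
  S.filter fun p => Even (xIndex S p)

/-- The points of `S` of odd index in the order by `x`-coordinate. -/
def oddPart (S : Finset (ℝ × ℝ)) : Finset (ℝ × ℝ) :=
  S.filter fun p => Odd (xIndex S p)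

/-- The height over `x` of the (non-vertical) line through `p` and `q`. -/
def lineAt (p q : ℝ × ℝ) (x : ℝ) : ℝ :=
  p.2 + (q.2 - p.2) / (q.1 - p.1) * (x - p.1)

/-- The line through `p` and `q` is above the point `r` (a vertical line never is). -/
def LineAbove (p q r : ℝ × ℝ) : Prop :=
  p.1 ≠ q.1 ∧ r.2 < lineAt p q r.1

/-- The line through `p` and `q` is below the point `r` (a vertical line never is). -/
def LineBelow (p q r : ℝ × ℝ) : Prop :=
  p.1 ≠ q.1 ∧ lineAt p q r.1 < r.2

/-- `X` is high above `Y`: every line determined by two points of `X` is above every point of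
`Y`, and every line determined by two points of `Y` is below every point of `X`. -/
def HighAbove (X Y : Finset (ℝ × ℝ)) : Prop :=
  (∀ p ∈ X, ∀ q ∈ X, p ≠ q → ∀ r ∈ Y, LineAbove p q r) ∧
    (∀ p ∈ Y, ∀ q ∈ Y, p ≠ q → ∀ r ∈ X, LineBelow p q r)

/-- `IsHorton k H`: the set `H` is a Horton set of `2 ^ k` points. -/
def IsHorton : ℕ → Finset (ℝ × ℝ) → Prop
  | 0, H => H.card = 1
  | k + 1, H =>
      H.card = 2 ^ (k + 1) ∧ Set.InjOn Prod.fst (H : Set (ℝ × ℝ)) ∧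
        IsHorton k (evenPart H) ∧ IsHorton k (oddPart H) ∧ HighAbove (oddPart H) (evenPart H)

end

end Horton

/-! A drawing enters only through its orientations and through the bounds that integrality and its
size M put on determinants. Listed in the order of the Horton set, its points form a `HighChain`, a
condition on signs of determinants. The drawing need not preserve the left-to-right order, but the
point of index 1 lies above all lines through even-indexed points, so it sees these in angular
order. The projective map `proj`, sending it to infinity, turns that into order by x-coordinate and
keeps orientations. In the image, gaps (up to a common factor) and heights have the form a / (b * c)
with integer determinants between 1 and 8M², so two gaps, or two positive heights, have ratio at
most R = (8M²)³.

Against this stands a growth estimate. If a block of width w has room W on both sides, the triangle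
over each of its halves is at least W / (2w) times as high as the triangle over the block
(`HighChain.height_growth`). Always passing to the narrower half gives w ≤ W / 2^s after s halvings,
so T halvings multiply the height by at least 2^(0 + 1 + ... + (T - 1)) / 2^T
(`HighChain.exists_height_ge`), and R must be at least this large. A starting block with enough room
exists unless R² ≥ 2^n (`exists_gap_le`). With T about 3k/4 and n of order 2^(k/4), either
alternative gives R ≥ 2^(k(k - 1)/4); a sixth root bounds M. -/

namespace Horton

noncomputable section

/-! ### Orientations as signs of determinants. -/

/-- Twice the signed area of the triangle `p q r`, positive when `r` lies to the left of the
oriented line from `p` to `q`. -/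
def cross (p q r : ℝ × ℝ) : ℝ :=
  (q.1 - p.1) * (r.2 - p.2) - (q.2 - p.2) * (r.1 - p.1)

/-- The signed vertical distance of `r` from the line through `p` and `q`. -/
def height (p q r : ℝ × ℝ) : ℝ :=
  cross p q r / (q.1 - p.1)

/-- On the index set `I`, the points whose index is an odd multiple of `2 ^ t` are high above those
whose index is a multiple of `2 ^ (t + 1)`, for all `t`. -/
def HighChain (I : Set ℕ) (P : ℕ → ℝ × ℝ) : Prop :=
  ∀ t a b c : ℕ, a < b →
    (2 ^ (t + 1) * a ∈ I → 2 ^ (t + 1) * b ∈ I → 2 ^ t * (2 * c + 1) ∈ I →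
      0 < cross (P (2 ^ (t + 1) * a)) (P (2 ^ (t + 1) * b)) (P (2 ^ t * (2 * c + 1)))) ∧
    (2 ^ t * (2 * a + 1) ∈ I → 2 ^ t * (2 * b + 1) ∈ I → 2 ^ (t + 1) * c ∈ I →
      cross (P (2 ^ t * (2 * a + 1))) (P (2 ^ t * (2 * b + 1))) (P (2 ^ (t + 1) * c)) < 0)

theorem orientation_eq_sign_neg_cross (p q r : ℝ × ℝ) :
    orientation p q r = SignType.sign (-cross p q r) := by
  unfold orientation cross
  congr 1
  ring

theorem cross_pos_iff {p q r : ℝ × ℝ} : 0 < cross p q r ↔ orientation p q r = -1 := by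
  rw [orientation_eq_sign_neg_cross, sign_eq_neg_one_iff, neg_lt_zero]

theorem cross_neg_iff {p q r : ℝ × ℝ} : cross p q r < 0 ↔ orientation p q r = 1 := by
  rw [orientation_eq_sign_neg_cross, sign_eq_one_iff, neg_pos]

theorem sub_lineAt {p q : ℝ × ℝ} (r : ℝ × ℝ) (h : p.1 < q.1) :
    r.2 - lineAt p q r.1 = height p q r := by
  have : q.1 - p.1 ≠ 0 := (sub_pos.2 h).ne'
  unfold lineAt height cross
  field_simp
  ring

theorem LineBelow.cross_pos {p q r : ℝ × ℝ} (h : p.1 < q.1) (hr : LineBelow p q r) :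
    0 < cross p q r := by
  have h1 := sub_lineAt r h
  have h2 : 0 < height p q r := by rw [← h1]; exact sub_pos.2 hr.2
  exact (div_pos_iff_of_pos_right (sub_pos.2 h)).1 h2

theorem LineAbove.cross_neg {p q r : ℝ × ℝ} (h : p.1 < q.1) (hr : LineAbove p q r) :
    cross p q r < 0 := by
  have h1 := sub_lineAt r h
  have h2 : height p q r < 0 := by rw [← h1]; exact sub_neg.2 hr.2
  by_contra hc
  exact absurd (div_nonneg (not_lt.1 hc) (sub_pos.2 h).le) (not_le.2 h2)

theorem IsHorton.card {k : ℕ} {H : Finset (ℝ × ℝ)} (h : IsHorton k H) : H.card = 2 ^ k := by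
  cases k with
  | zero => simpa [IsHorton] using h
  | succ k => exact h.1

theorem IsHorton.injOn_fst {k : ℕ} {H : Finset (ℝ × ℝ)} (h : IsHorton k H) :
    Set.InjOn Prod.fst (H : Set (ℝ × ℝ)) := by
  cases k with
  | zero =>
    intro p hp q hq _
    exact Finset.card_le_one.1 (le_of_eq h) p hp q hq
  | succ k => exact h.2.1

/-! ### From Horton sets and their drawings to indexed chains. -/

/-- A finite set with distinct `x`-coordinates can be listed by increasing `x`-coordinate. -/
theorem exists_enumeration {H : Finset (ℝ × ℝ)} (hH : Set.InjOn Prod.fst (H : Set (ℝ × ℝ))) :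
    ∃ P : ℕ → ℝ × ℝ, (∀ i < H.card, P i ∈ H) ∧
      ∀ i j, i < j → j < H.card → (P i).1 < (P j).1 := by
  have hc : (H.image Prod.fst).card = H.card := Finset.card_image_of_injOn hH
  let f := (H.image Prod.fst).orderEmbOfFin hc
  have hf : ∀ i, ∃ p ∈ H, p.1 = f i := fun i =>
    Finset.mem_image.1 (Finset.orderEmbOfFin_mem _ hc i)
  choose g hg hgf using hf
  refine ⟨fun i => if h : i < H.card then g ⟨i, h⟩ else 0, fun i hi => ?_, fun i j hij hj => ?_⟩
  · simp [hi, hg]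
  · have hi := hij.trans hj
    simp only [hi, hj, dif_pos, hgf]
    exact f.strictMono hij

theorem xIndex_enumeration {H : Finset (ℝ × ℝ)} {P : ℕ → ℝ × ℝ} (hP : ∀ i < H.card, P i ∈ H)
    (hmono : ∀ i j, i < j → j < H.card → (P i).1 < (P j).1) {i : ℕ} (hi : i < H.card) :
    xIndex H (P i) = i := by
  have hinj : Set.InjOn P (Finset.range H.card : Set ℕ) := by
    intro a ha b hb hab
    simp only [Finset.coe_range, Set.mem_Iio] at ha hb
    rcases lt_trichotomy a b with h | h | h
    · exact absurd (congrArg Prod.fst hab) (hmono a b h hb).ne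
    · exact h
    · exact absurd (congrArg Prod.fst hab) (hmono b a h ha).ne'
  have hH : (Finset.range H.card).image P = H := by
    apply Finset.eq_of_subset_of_card_le
    · intro p hp
      obtain ⟨a, ha, rfl⟩ := Finset.mem_image.1 hp
      exact hP a (Finset.mem_range.1 ha)
    · rw [Finset.card_image_of_injOn hinj, Finset.card_range]
  have hfil : (H.filter fun q => q.1 < (P i).1) = (Finset.range i).image P := by
    ext q
    simp only [Finset.mem_filter, Finset.mem_image, Finset.mem_range]
    constructor
    · rintro ⟨hq, hlt⟩
      rw [← hH] at hq
      obtain ⟨a, ha, rfl⟩ := Finset.mem_image.1 hq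
      refine ⟨a, ?_, rfl⟩
      by_contra hai
      rcases (not_lt.1 hai).eq_or_lt with h | h
      · subst h; exact lt_irrefl _ hlt
      · exact lt_asymm hlt (hmono i a h (Finset.mem_range.1 ha))
    · rintro ⟨a, ha, rfl⟩
      exact ⟨hP a (ha.trans hi), hmono a i ha hi⟩
  rw [xIndex, hfil, Finset.card_image_of_injOn, Finset.card_range]
  exact hinj.mono (by simpa using Set.Iio_subset_Iio hi.le)

/-- Level t = 0 is the separation of the odd part from the even part; the higher levels come from
the even part, reindexed by halving. The recursive structure of the odd part is never needed. -/
theorem IsHorton.highChain {k : ℕ} {H : Finset (ℝ × ℝ)} (h : IsHorton k H) {P : ℕ → ℝ × ℝ}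
    (hP : ∀ i < 2 ^ k, P i ∈ H) (hmono : ∀ i j, i < j → j < 2 ^ k → (P i).1 < (P j).1) :
    HighChain (Set.Iio (2 ^ k)) P := by
  induction k generalizing H P with
  | zero =>
    intro t a b c hab
    simp only [Set.mem_Iio, pow_zero, Nat.lt_one_iff, mul_eq_zero]
    have h2 : (2 : ℕ) ^ t ≠ 0 := by positivity
    have h2' : (2 : ℕ) ^ (t + 1) ≠ 0 := by positivity
    constructor
    · intro _ hb; omega
    · intro _ hb; omega
  | succ k ih =>
    have hcard := h.card
    have hidx : ∀ i < 2 ^ (k + 1), xIndex H (P i) = i := fun i hi =>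
      xIndex_enumeration (by rwa [hcard]) (by rwa [hcard]) (by rwa [hcard])
    obtain ⟨-, -, heven, -, habove, hbelow⟩ := h
    have he : ∀ i, 2 * i < 2 ^ (k + 1) → P (2 * i) ∈ evenPart H := fun i hi =>
      Finset.mem_filter.2 ⟨hP _ hi, by rw [hidx _ hi]; exact even_two_mul i⟩
    have ho : ∀ i, 2 * i + 1 < 2 ^ (k + 1) → P (2 * i + 1) ∈ oddPart H := fun i hi =>
      Finset.mem_filter.2 ⟨hP _ hi, by rw [hidx _ hi]; exact odd_two_mul_add_one i⟩
    have hne : ∀ i j, i < j → j < 2 ^ (k + 1) → P i ≠ P j := fun i j hij hj he =>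
      (hmono i j hij hj).ne (congrArg Prod.fst he)
    have hrec := ih heven (P := fun i => P (2 * i))
      (fun i hi => he i (by rw [pow_succ]; omega))
      (fun i j hij hj => hmono _ _ (by omega) (by rw [pow_succ]; omega))
    intro t a b c hab
    cases t with
    | zero =>
      simp only [Set.mem_Iio, zero_add, pow_one, pow_zero, one_mul]
      constructor
      · intro ha hb hc
        have hlt := hmono (2 * a) (2 * b) (by omega) hb
        exact (hbelow _ (he a ha) _ (he b hb) (hne _ _ (by omega) hb) _ (ho c hc)).cross_pos hlt
      · intro ha hb hc
        have hlt := hmono (2 * a + 1) (2 * b + 1) (by omega) hb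
        exact (habove _ (ho a ha) _ (ho b hb) (hne _ _ (by omega) hb) _ (he c hc)).cross_neg hlt
    | succ t =>
      have e1 : ∀ d, 2 ^ (t + 1 + 1) * d = 2 * (2 ^ (t + 1) * d) := fun d => by ring
      have e2 : ∀ d, 2 ^ (t + 1) * d = 2 * (2 ^ t * d) := fun d => by ring
      have hI : ∀ d, 2 * d ∈ Set.Iio (2 ^ (k + 1)) → d ∈ Set.Iio (2 ^ k) := fun d hd => by
        simp only [Set.mem_Iio, pow_succ] at hd ⊢; omega
      obtain ⟨r1, r2⟩ := hrec t a b c hab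
      constructor
      · intro ha hb hc
        rw [e1] at ha hb
        rw [e2] at hc
        rw [e1, e1, e2 (2 * c + 1)]
        exact r1 (hI _ ha) (hI _ hb) (hI _ hc)
      · intro ha hb hc
        rw [e2] at ha hb
        rw [e1] at hc
        rw [e2 (2 * a + 1), e2 (2 * b + 1), e1]
        exact r2 (hI _ ha) (hI _ hb) (hI _ hc)

theorem HighChain.of_orientation_eq {I : Set ℕ} {P Q : ℕ → ℝ × ℝ} (h : HighChain I P)
    (hPQ : ∀ i ∈ I, ∀ j ∈ I, ∀ l ∈ I,
      orientation (Q i) (Q j) (Q l) = orientation (P i) (P j) (P l)) : HighChain I Q := by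
  intro t a b c hab
  obtain ⟨h1, h2⟩ := h t a b c hab
  refine ⟨fun ha hb hc => ?_, fun ha hb hc => ?_⟩
  · rw [cross_pos_iff, hPQ _ ha _ hb _ hc, ← cross_pos_iff]; exact h1 ha hb hc
  · rw [cross_neg_iff, hPQ _ ha _ hb _ hc, ← cross_neg_iff]; exact h2 ha hb hc

/-- A drawing of a Horton set is listed by integer points forming a `HighChain`. -/
theorem IsHorton.exists_highChain_of_isDrawing {k : ℕ} {H : Finset (ℝ × ℝ)} (h : IsHorton k H)
    {D : Finset (ℤ × ℤ)} (hD : IsDrawing D H) :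
    ∃ z : ℕ → ℤ × ℤ, (∀ i < 2 ^ k, z i ∈ D) ∧
      HighChain (Set.Iio (2 ^ k)) fun i => toPlane (z i) := by
  obtain ⟨P, hP, hmono⟩ := exists_enumeration h.injOn_fst
  rw [h.card] at hP hmono
  obtain ⟨e, he⟩ := hD
  have hz : ∀ i, ∃ z : ℤ × ℤ, ∀ hi : i < 2 ^ k,
      z ∈ D ∧ toPlane z = (e.symm ⟨P i, hP i hi⟩ : ℝ × ℝ) := by
    intro i
    by_cases hi : i < 2 ^ k
    · obtain ⟨z, hz, hze⟩ := Finset.mem_image.1 (e.symm ⟨P i, hP i hi⟩).2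
      exact ⟨z, fun _ => ⟨hz, hze⟩⟩
    · exact ⟨0, fun h => absurd h hi⟩
  choose z hz using hz
  refine ⟨z, fun i hi => (hz i hi).1, (h.highChain hP hmono).of_orientation_eq ?_⟩
  intro i hi j hj l hl
  have := he (e.symm ⟨P i, hP i hi⟩) (e.symm ⟨P j, hP j hj⟩) (e.symm ⟨P l, hP l hl⟩)
  simp only [Equiv.apply_symm_apply] at this
  simp only [(hz i hi).2, (hz j hj).2, (hz l hl).2]
  exact this.symm

/-! ### Growth of heights when a block is halved. -/

theorem cross_reflect (p q r : ℝ × ℝ) :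
    cross (-p.1, p.2) (-q.1, q.2) (-r.1, r.2) = cross q p r := by
  unfold cross
  ring

theorem cross_cyclic (p q r : ℝ × ℝ) : cross p q r = cross q r p := by
  unfold cross
  ring

theorem height_reflect (p q r : ℝ × ℝ) :
    height (-p.1, p.2) (-q.1, q.2) (-r.1, r.2) = height q p r := by
  unfold height
  rw [cross_reflect]
  congr 1
  ring

/-- The heart of the growth estimate, in coordinates in which `p` and `q` lie on the `x`-axis:
`σ`, `h`, `A`, `B`, `U`, `V` are the depth of `s` and the heights of `e`, `eL`, `eR`, `cL`, `cR`
relative to that axis. -/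
theorem depth_le_height_aux {xp xe xq xs xeL xeR xcL xcR σ h A B U V W : ℝ}
    (hpe : xp < xe) (heq : xe < xq) (hqs : xq < xs) (hW : xs - xp ≤ W)
    (hcL : W ≤ xp - xcL) (heL : W ≤ xp - xeL) (hcR : W ≤ xcR - xs) (heR : W ≤ xeR - xs)
    (hσ : 0 < σ) (hh : 0 < h) (hB : 0 < B)
    (hA : σ * (xq - xeL) < A * (xs - xq))
    (hV : V * (xe - xeL) < h * (xe - xeL) + (h - A) * (xcR - xe))
    (hU : U * (xeR - xe) < h * (xeR - xe) + (B - h) * (xcL - xe))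
    (hp : 0 < U * (xcR - xp) + V * (xp - xcL)) :
    W * σ ≤ 8 * h * (xs - xq) := by
  have hW0 : 0 < W := by linarith
  obtain ⟨α, hα⟩ : ∃ α, α = xp - xcL := ⟨_, rfl⟩
  obtain ⟨δ, hδ⟩ : ∃ δ, δ = xe - xp := ⟨_, rfl⟩
  obtain ⟨β, hβ⟩ : ∃ β, β = xeR - xe := ⟨_, rfl⟩
  obtain ⟨γ, hγ⟩ : ∃ γ, γ = xe - xeL := ⟨_, rfl⟩
  obtain ⟨κ, hκ⟩ : ∃ κ, κ = xcR - xe := ⟨_, rfl⟩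
  obtain ⟨v, hv⟩ : ∃ v, v = xs - xq := ⟨_, rfl⟩
  have hαW : W ≤ α := by linarith
  have hβW : W ≤ β := by linarith
  have hγW : W ≤ γ := by linarith
  have hκW : W ≤ κ := by linarith
  have hδ0 : 0 < δ := by linarith
  have hδW : δ ≤ W := by linarith
  have hv0 : 0 < v := by linarith
  have hα0 : 0 < α := by linarith
  have hβ0 : 0 < β := by linarith
  have hγ0 : 0 < γ := by linarith
  have hκ0 : 0 < κ := by linarith
  -- bounds in terms of quotients
  have hA' : σ / v * γ < A := by
    rw [div_mul_eq_mul_div, div_lt_iff₀ hv0]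
    have : σ * γ ≤ σ * (xq - xeL) := by
      apply mul_le_mul_of_nonneg_left _ hσ.le; linarith
    rw [hv]; linarith
  have hV' : V < h + h * κ / γ - σ / v * κ := by
    have h1 : V * γ < h * γ + (h - σ / v * γ) * κ := by
      have : (h - A) * κ ≤ (h - σ / v * γ) * κ := by
        apply mul_le_mul_of_nonneg_right _ hκ0.le; linarith
      rw [← hγ, ← hκ] at hV; linarith
    have h2 : (h + h * κ / γ - σ / v * κ) * γ = h * γ + (h - σ / v * γ) * κ := by
      field_simp
      ring
    rw [← h2] at h1
    exact lt_of_mul_lt_mul_right h1 hγ0.le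
  have hU' : U < h + h * (α + δ) / β := by
    have h1 : U * β < h * β + h * (α + δ) := by
      have e1 : xcL - xe = -(α + δ) := by linarith
      rw [← hβ, e1] at hU
      have : 0 < B * (α + δ) := by positivity
      linarith
    have h2 : (h + h * (α + δ) / β) * β = h * β + h * (α + δ) := by
      field_simp
    rw [← h2] at h1
    exact lt_of_mul_lt_mul_right h1 hβ0.le
  have hp' : 0 < (h + h * (α + δ) / β) * (κ + δ) + (h + h * κ / γ - σ / v * κ) * α := by
    have e1 : xcR - xp = κ + δ := by linarith
    rw [e1, ← hα] at hp
    have := mul_lt_mul_of_pos_right hU' (by linarith : 0 < κ + δ)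
    have := mul_lt_mul_of_pos_right hV' hα0
    linarith
  -- The four positive terms of `hp'` are at most 2, 4, 1 and 1 times h * κ * α / W, whence the
  -- constant 8.
  have q1 : h * (κ + δ) ≤ 2 * (h * (κ * α)) / W := by
    rw [le_div_iff₀ hW0]
    have : (κ + δ) * W ≤ (2 * κ) * α := by
      apply mul_le_mul <;> linarith
    nlinarith
  have q2 : h * (α + δ) / β * (κ + δ) ≤ 4 * (h * (κ * α)) / W := by
    have : h * (α + δ) / β ≤ h * (2 * α) / W := by
      apply div_le_div₀ (by positivity) _ hW0 hβW
      apply mul_le_mul_of_nonneg_left _ hh.le; linarith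
    calc h * (α + δ) / β * (κ + δ) ≤ h * (2 * α) / W * (2 * κ) := by
          apply mul_le_mul this (by linarith) (by linarith) (by positivity)
      _ = 4 * (h * (κ * α)) / W := by ring
  have q3 : h * α ≤ h * (κ * α) / W := by
    rw [le_div_iff₀ hW0]
    have : W * α ≤ κ * α := mul_le_mul_of_nonneg_right hκW hα0.le
    nlinarith
  have q4 : h * κ / γ * α ≤ h * (κ * α) / W := by
    have : h * κ / γ ≤ h * κ / W := by
      apply div_le_div_of_nonneg_left (by positivity) hW0 hγW
    calc h * κ / γ * α ≤ h * κ / W * α := mul_le_mul_of_nonneg_right this hα0.le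
      _ = h * (κ * α) / W := by ring
  have key : σ / v * (κ * α) ≤ 8 * h / W * (κ * α) := by
    have : 8 * h / W * (κ * α) = 2 * (h * (κ * α)) / W + 4 * (h * (κ * α)) / W
        + h * (κ * α) / W + h * (κ * α) / W := by ring
    rw [this]
    linarith
  have key' := le_of_mul_le_mul_right key (by positivity)
  rw [div_le_div_iff₀ hv0 hW0] at key'
  rw [← hv]
  linarith

/-- If `e` lies between `p` and `q`, then its height over `p q` is large compared with the height
of `q` over `p s`. -/
theorem height_growth_left {p q s e eL eR cL cR : ℝ × ℝ} {W : ℝ}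
    (hpe : p.1 < e.1) (heq : e.1 < q.1) (hqs : q.1 < s.1) (hW : s.1 - p.1 ≤ W)
    (hcL : W ≤ p.1 - cL.1) (heL : W ≤ p.1 - eL.1) (hcR : W ≤ cR.1 - s.1) (heR : W ≤ eR.1 - s.1)
    (hpsq : 0 < cross p s q) (hpqe : 0 < cross p q e) (hpqeR : 0 < cross p q eR)
    (hqseL : 0 < cross q s eL) (heLecR : cross eL e cR < 0) (heeRcL : cross e eR cL < 0)
    (hcLcRp : cross cL cR p < 0) :
    W * height p s q ≤ 2 * (s.1 - p.1) * height p q e := by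
  have hpq : p.1 < q.1 := hpe.trans heq
  -- A vertical shear makes `p q` the horizontal axis; determinants and heights do not change.
  set m := (q.2 - p.2) / (q.1 - p.1) with hm
  have hqp : q.1 - p.1 ≠ 0 := (sub_pos.2 hpq).ne'
  have hmq : q.2 - p.2 = m * (q.1 - p.1) := by rw [hm]; field_simp
  let y : ℝ × ℝ → ℝ := fun r => r.2 - p.2 - m * (r.1 - p.1)
  have hy : ∀ a b c : ℝ × ℝ,
      cross a b c = (b.1 - a.1) * (y c - y a) - (y b - y a) * (c.1 - a.1) := by
    intro a b c; simp only [y, cross]; ring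
  have yp : y p = 0 := by simp [y]
  have yq : y q = 0 := by simp only [y, hmq]; ring
  have hc : ∀ r, cross p q r = (q.1 - p.1) * y r := by
    intro r; rw [hy, yp, yq]; ring
  rw [hc] at hpqe hpqeR
  have hqp0 := sub_pos.2 hpq
  have he0 : 0 < y e := pos_of_mul_pos_right hpqe hqp0.le
  have heR0 : 0 < y eR := pos_of_mul_pos_right hpqeR hqp0.le
  have hps : cross p s q = (-y s) * (q.1 - p.1) := by rw [hy, yp, yq]; ring
  have hs0 : 0 < -y s := by rw [hps] at hpsq; exact pos_of_mul_pos_left hpsq hqp0.le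
  rw [hy] at hqseL heLecR heeRcL hcLcRp
  rw [yq] at hqseL
  rw [yp] at hcLcRp
  have main := depth_le_height_aux (xp := p.1) (xe := e.1) (xq := q.1) (xs := s.1) (xeL := eL.1)
    (xeR := eR.1) (xcL := cL.1) (xcR := cR.1) (σ := -y s) (h := y e) (A := y eL) (B := y eR)
    (U := y cL) (V := y cR) (W := W) hpe heq hqs hW hcL heL hcR heR hs0 he0 heR0
    (by linarith) (by linarith) (by linarith) (by linarith)
  have hpse : height p q e = y e := by
    rw [height, hc]; field_simp
  rw [hpse, height, hps]
  have hsp : 0 < s.1 - p.1 := by linarith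
  rw [mul_div_assoc', div_le_iff₀ hsp]
  have hsq0 : 0 < s.1 - q.1 := by linarith
  -- Removes the position of `q` between `p` and `s`, turning the constant 8 into 2.
  have amgm : 4 * ((q.1 - p.1) * (s.1 - q.1)) ≤ (s.1 - p.1) * (s.1 - p.1) := by
    nlinarith [sq_nonneg ((q.1 - p.1) - (s.1 - q.1))]
  calc W * (-y s * (q.1 - p.1)) = (W * (-y s)) * (q.1 - p.1) := by ring
    _ ≤ (8 * y e * (s.1 - q.1)) * (q.1 - p.1) := mul_le_mul_of_nonneg_right main hqp0.le
    _ = 2 * y e * (4 * ((q.1 - p.1) * (s.1 - q.1))) := by ring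
    _ ≤ 2 * y e * ((s.1 - p.1) * (s.1 - p.1)) := mul_le_mul_of_nonneg_left amgm (by positivity)
    _ = 2 * (s.1 - p.1) * y e * (s.1 - p.1) := by ring

/-- The mirror image of `height_growth_left`. -/
theorem height_growth_right {p q s e eL eR cL cR : ℝ × ℝ} {W : ℝ}
    (hpq : p.1 < q.1) (hqe : q.1 < e.1) (hes : e.1 < s.1) (hW : s.1 - p.1 ≤ W)
    (hcL : W ≤ p.1 - cL.1) (heL : W ≤ p.1 - eL.1) (hcR : W ≤ cR.1 - s.1) (heR : W ≤ eR.1 - s.1)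
    (hpsq : 0 < cross p s q) (hqse : 0 < cross q s e) (hpqeR : 0 < cross p q eR)
    (hqseL : 0 < cross q s eL) (heLecR : cross eL e cR < 0) (heeRcL : cross e eR cL < 0)
    (hcLcRs : cross cL cR s < 0) :
    W * height p s q ≤ 2 * (s.1 - p.1) * height q s e := by
  have := height_growth_left (p := (-s.1, s.2)) (q := (-q.1, q.2)) (s := (-p.1, p.2))
    (e := (-e.1, e.2)) (eL := (-eR.1, eR.2)) (eR := (-eL.1, eL.2)) (cL := (-cR.1, cR.2))
    (cR := (-cL.1, cL.2)) (W := W) (by simpa) (by simpa) (by simpa) (by simp only; linarith)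
    (by simp only; linarith) (by simp only; linarith) (by simp only; linarith)
    (by simp only; linarith) (by rwa [cross_reflect]) (by rwa [cross_reflect])
    (by rwa [cross_reflect]) (by rwa [cross_reflect]) (by rwa [cross_reflect])
    (by rwa [cross_reflect]) (by rwa [cross_reflect])
  rw [height_reflect, height_reflect] at this
  simp only at this
  linarith

/-! ### Iterated halving of a block. -/

/-- Self-similarity of chains: it lets one growth estimate, stated for the two lowest levels, serve
at every scale. -/
theorem HighChain.comp_two_pow {I : Set ℕ} {P : ℕ → ℝ × ℝ} (h : HighChain I P) (d : ℕ) :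
    HighChain {i | 2 ^ d * i ∈ I} fun i => P (2 ^ d * i) := by
  intro t a b c hab
  obtain ⟨h1, h2⟩ := h (d + t) a b c hab
  have e1 : ∀ i, 2 ^ d * (2 ^ (t + 1) * i) = 2 ^ (d + t + 1) * i := fun i => by ring
  have e2 : ∀ i, 2 ^ d * (2 ^ t * i) = 2 ^ (d + t) * i := fun i => by ring
  simp only [Set.mem_ofPred_eq, e1, e2]
  exact ⟨h1, h2⟩

theorem HighChain.mono {I J : Set ℕ} {P : ℕ → ℝ × ℝ} (h : HighChain I P) (hJ : J ⊆ I) :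
    HighChain J P := fun t a b c hab =>
  ⟨fun ha hb hc => (h t a b c hab).1 (hJ ha) (hJ hb) (hJ hc),
    fun ha hb hc => (h t a b c hab).2 (hJ ha) (hJ hb) (hJ hc)⟩

/-- Both halves of the block of five points starting at `4 * u` carry a triangle that is high
compared with the triangle spanned by the block. -/
theorem HighChain.height_growth {K u r : ℕ} {G : ℕ → ℝ × ℝ} {W : ℝ}
    (h : HighChain (Set.Ioo 0 K) G) (hmono : StrictMonoOn (fun i => (G i).1) (Set.Ioo 0 K))
    (hu : 0 < u) (hur : u < r) (hK : 4 * r + 2 < K)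
    (hW : (G (4 * u + 4)).1 - (G (4 * u)).1 ≤ W) (hL : W ≤ (G (4 * u)).1 - (G 2).1)
    (hR : W ≤ (G (4 * r)).1 - (G (4 * u + 4)).1) :
    W * height (G (4 * u)) (G (4 * u + 4)) (G (4 * u + 2)) ≤
        2 * ((G (4 * u + 4)).1 - (G (4 * u)).1) *
          height (G (4 * u)) (G (4 * u + 2)) (G (4 * u + 1)) ∧
      W * height (G (4 * u)) (G (4 * u + 4)) (G (4 * u + 2)) ≤
        2 * ((G (4 * u + 4)).1 - (G (4 * u)).1) *
          height (G (4 * u + 2)) (G (4 * u + 4)) (G (4 * u + 3)) := by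
  have hx : ∀ i j, 0 < i → i < j → j < K → (G i).1 < (G j).1 := fun i j hi hij hj =>
    hmono ⟨hi, hij.trans hj⟩ ⟨hi.trans hij, hj⟩ hij
  have above : ∀ a b c, 0 < a → a < b → 2 * b < K → 2 * c + 1 < K →
      0 < cross (G (2 * a)) (G (2 * b)) (G (2 * c + 1)) := fun a b c ha hab hb hc => by
    have := (h 0 a b c hab).1
    simp only [zero_add, pow_one, pow_zero, one_mul, Set.mem_Ioo] at this
    exact this (by omega) (by omega) (by omega)
  have below : ∀ a b c, a < b → 2 * b + 1 < K → 0 < c → 2 * c < K →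
      cross (G (2 * a + 1)) (G (2 * b + 1)) (G (2 * c)) < 0 := fun a b c hab hb hc hc' => by
    have := (h 0 a b c hab).2
    simp only [zero_add, pow_one, pow_zero, one_mul, Set.mem_Ioo] at this
    exact this (by omega) (by omega) (by omega)
  have above' : 0 < cross (G (4 * u)) (G (4 * u + 4)) (G (4 * u + 2)) := by
    have := (h 1 u (u + 1) u (by omega)).1
    simp only [one_add_one_eq_two, pow_one, Set.mem_Ioo] at this
    have := this (by omega) (by omega) (by omega)
    convert this using 2 <;> ring_nf
  have below' : ∀ c, 0 < c → 4 * c < K → cross (G 2) (G (4 * r + 2)) (G (4 * c)) < 0 := by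
    intro c hc hc'
    have := (h 1 0 r c (by omega)).2
    simp only [one_add_one_eq_two, pow_one, Set.mem_Ioo] at this
    have := this (by omega) (by omega) (by omega)
    convert this using 2 <;> ring_nf
  have x12 := hx 1 2 (by omega) (by omega) (by omega)
  have xr1 := hx (4 * r) (4 * r + 1) (by omega) (by omega) (by omega)
  have xr2 := hx (4 * r) (4 * r + 2) (by omega) (by omega) (by omega)
  have a1 := above (2 * u) (2 * u + 1) (2 * r) (by omega) (by omega) (by omega) (by omega)
  have a2 := above (2 * u + 1) (2 * u + 2) 0 (by omega) (by omega) (by omega) (by omega)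
  have a3 := above (2 * u) (2 * u + 1) (2 * u) (by omega) (by omega) (by omega) (by omega)
  have a4 := above (2 * u + 1) (2 * u + 2) (2 * u + 1) (by omega) (by omega) (by omega) (by omega)
  have b1 := below 0 (2 * u) (2 * r + 1) (by omega) (by omega) (by omega) (by omega)
  have b2 := below (2 * u) (2 * r) 1 (by omega) (by omega) (by omega) (by omega)
  have b3 := below 0 (2 * u + 1) (2 * r + 1) (by omega) (by omega) (by omega) (by omega)
  have b4 := below (2 * u + 1) (2 * r) 1 (by omega) (by omega) (by omega) (by omega)
  simp only [mul_add, mul_zero, mul_one, ← mul_assoc, zero_add, Nat.reduceMul, add_assoc,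
    Nat.reduceAdd] at a1 a2 a3 a4 b1 b2 b3 b4
  have c1 := below' u hu (by omega)
  have c2 := below' (u + 1) (by omega) (by omega)
  simp only [mul_add, mul_one] at c2
  constructor
  · exact height_growth_left (hx _ _ (by omega) (by omega) (by omega))
      (hx _ _ (by omega) (by omega) (by omega)) (hx _ _ (by omega) (by omega) (by omega)) hW
      hL (by linarith) (by linarith) (by linarith) above' a3 a1 a2 b1 b2 c1
  · exact height_growth_right (hx _ _ (by omega) (by omega) (by omega))
      (hx _ _ (by omega) (by omega) (by omega)) (hx _ _ (by omega) (by omega) (by omega)) hW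
      hL (by linarith) (by linarith) (by linarith) above' a4 a1 a2 b3 b4 c2

/-- Repeated halving of the block of indices between `2 ^ (T + 1) * j` and
`2 ^ (T + 1) * (j + 1)`. -/
theorem HighChain.exists_height_ge {n T j : ℕ} {P : ℕ → ℝ × ℝ}
    (h : HighChain (Set.Ioo 0 (2 ^ (T + 1) * (n + 1))) P)
    (hmono : StrictMonoOn (fun i => (P i).1) (Set.Ioo 0 (2 ^ (T + 1) * (n + 1))))
    (hj : 2 ≤ j) (hjn : j + 1 ≤ n)
    (hL : (P (2 ^ (T + 1) * (j + 1))).1 - (P (2 ^ (T + 1) * j)).1 ≤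
      (P (2 ^ (T + 1) * j)).1 - (P (2 ^ (T + 1))).1)
    (hR : (P (2 ^ (T + 1) * (j + 1))).1 - (P (2 ^ (T + 1) * j)).1 ≤
      (P (2 ^ (T + 1) * n)).1 - (P (2 ^ (T + 1) * (j + 1))).1) (s t : ℕ) (hst : s + t = T) :
    ∃ u, 2 ^ (T + 1) * j ≤ 2 ^ t * (2 * u) ∧ 2 ^ t * (2 * u + 2) ≤ 2 ^ (T + 1) * (j + 1) ∧
      2 ^ s * ((P (2 ^ t * (2 * u + 2))).1 - (P (2 ^ t * (2 * u))).1) ≤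
        (P (2 ^ (T + 1) * (j + 1))).1 - (P (2 ^ (T + 1) * j)).1 ∧
      2 ^ (∑ i ∈ Finset.range s, i) *
        height (P (2 ^ T * (2 * j))) (P (2 ^ T * (2 * j + 2))) (P (2 ^ T * (2 * j + 1))) ≤
      2 ^ s * height (P (2 ^ t * (2 * u))) (P (2 ^ t * (2 * u + 2))) (P (2 ^ t * (2 * u + 1))) := by
  have hx : ∀ i k, 0 < i → i < k → k < 2 ^ (T + 1) * (n + 1) → (P i).1 < (P k).1 :=
    fun i j hi hij hj => hmono ⟨hi, hij.trans hj⟩ ⟨hi.trans hij, hj⟩ hij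
  have hx' : ∀ i k, 0 < i → i ≤ k → k < 2 ^ (T + 1) * (n + 1) → (P i).1 ≤ (P k).1 :=
    fun i j hi hij hj => hmono.monotoneOn ⟨hi, hij.trans_lt hj⟩ ⟨hi.trans_le hij, hj⟩ hij
  induction s generalizing t with
  | zero =>
    obtain rfl : t = T := by omega
    have e1 : 2 ^ t * (2 * j) = 2 ^ (t + 1) * j := by ring
    have e2 : 2 ^ t * (2 * j + 2) = 2 ^ (t + 1) * (j + 1) := by ring
    exact ⟨j, e1.ge, e2.le, by simp [e1, e2], by simp⟩
  | succ s ih =>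
    obtain ⟨u, hu1, hu2, hw, hh⟩ := ih (t + 1) (by omega)
    set W := (P (2 ^ (T + 1) * (j + 1))).1 - (P (2 ^ (T + 1) * j)).1 with hWdef
    have hT : 2 ^ (T + 1) = 2 ^ t * (4 * 2 ^ s) := by
      rw [← hst]; ring
    have h2t : 0 < 2 ^ t := by positivity
    have h2s : 0 < 2 ^ s := by positivity
    have h2T : 0 < 2 ^ (T + 1) := by positivity
    have e0 : 2 ^ (t + 1) * (2 * u) = 2 ^ t * (4 * u) := by ring
    have e1 : 2 ^ (t + 1) * (2 * u + 1) = 2 ^ t * (4 * u + 2) := by ring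
    have e2 : 2 ^ (t + 1) * (2 * u + 2) = 2 ^ t * (4 * u + 4) := by ring
    have en : 2 ^ (T + 1) * n = 2 ^ t * (4 * (2 ^ s * n)) := by rw [hT]; ring
    have ej : 2 ^ (T + 1) * j = 2 ^ t * (4 * (2 ^ s * j)) := by rw [hT]; ring
    have ej1 : 2 ^ (T + 1) * (j + 1) = 2 ^ t * (4 * (2 ^ s * (j + 1))) := by rw [hT]; ring
    have en1 : 2 ^ (T + 1) * (n + 1) = 2 ^ t * (4 * (2 ^ s * n) + 4 * 2 ^ s) := by rw [hT]; ring
    rw [e0] at hu1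
    rw [e2] at hu2
    rw [e0, e2] at hw
    rw [e0, e1, e2] at hh
    have hju : 2 ^ s * j ≤ u := by
      rw [ej] at hu1
      have := Nat.le_of_mul_le_mul_left hu1 h2t
      omega
    have huj : u + 1 ≤ 2 ^ s * (j + 1) := by
      rw [ej1] at hu2
      have := Nat.le_of_mul_le_mul_left hu2 h2t
      omega
    have hun : u < 2 ^ s * n := lt_of_lt_of_le huj (Nat.mul_le_mul_left _ hjn)
    have hu0 : 0 < u := lt_of_lt_of_le (by positivity) hju
    have hI : {i | 2 ^ t * i ∈ Set.Ioo 0 (2 ^ (T + 1) * (n + 1))} =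
        Set.Ioo 0 (4 * (2 ^ s * n) + 4 * 2 ^ s) := by
      ext i
      simp only [Set.mem_ofPred_eq, Set.mem_Ioo, en1, mul_pos_iff_of_pos_left h2t,
        mul_lt_mul_iff_right₀ h2t]
    have hG := h.comp_two_pow t
    rw [hI] at hG
    have hGmono : StrictMonoOn (fun i => (P (2 ^ t * i)).1)
        (Set.Ioo 0 (4 * (2 ^ s * n) + 4 * 2 ^ s)) := by
      intro a ha b hb hab
      rw [← hI] at ha hb
      exact hmono ha hb ((mul_lt_mul_iff_right₀ h2t).2 hab)
    have hjlt : 2 ^ (T + 1) * (j + 1) < 2 ^ (T + 1) * (n + 1) := by gcongr; omega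
    have hnlt : 2 ^ (T + 1) * n < 2 ^ (T + 1) * (n + 1) := by gcongr; omega
    have hu4 : 2 ^ t * (4 * u) < 2 ^ t * (4 * u + 4) := by gcongr; omega
    have hx4 := hx _ _ (by positivity) hu4 (hu2.trans_lt hjlt)
    have hxj := hx' _ _ (by positivity) hu1 (hu4.trans (hu2.trans_lt hjlt))
    have hxj1 := hx' _ _ (by positivity) hu2 hjlt
    have hx2 : (P (2 ^ t * 2)).1 ≤ (P (2 ^ (T + 1))).1 := by
      apply hx' _ _ (by positivity)
      · rw [hT]; gcongr; omega
      · nlinarith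
    have hwW : (P (2 ^ t * (4 * u + 4))).1 - (P (2 ^ t * (4 * u))).1 ≤ W := by
      rw [hWdef]; linarith
    obtain ⟨g1, g2⟩ := hG.height_growth hGmono hu0 hun (by omega) (W := W) hwW
      (by linarith) (by rw [← en]; linarith)
    have hw0 : 0 < (P (2 ^ t * (4 * u + 4))).1 - (P (2 ^ t * (4 * u))).1 := sub_pos.2 hx4
    -- The block has width at most W / 2^s, so the height gains a factor of at least 2^s / 2: the
    -- 2^s adds a term to the exponent sum, the 2 goes into 2^(s + 1) on the right.
    have grow : ∀ d : ℝ, W * height (P (2 ^ t * (4 * u))) (P (2 ^ t * (4 * u + 4)))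
          (P (2 ^ t * (4 * u + 2))) ≤
          2 * ((P (2 ^ t * (4 * u + 4))).1 - (P (2 ^ t * (4 * u))).1) * d →
        2 ^ (∑ i ∈ Finset.range (s + 1), i) *
        height (P (2 ^ T * (2 * j))) (P (2 ^ T * (2 * j + 2))) (P (2 ^ T * (2 * j + 1))) ≤
        2 ^ (s + 1) * d := by
      intro d hd
      set H := height (P (2 ^ t * (4 * u))) (P (2 ^ t * (4 * u + 4))) (P (2 ^ t * (4 * u + 2)))
      have hH : 0 ≤ H := by
        have hc : 0 < cross (P (2 ^ t * (4 * u))) (P (2 ^ t * (4 * u + 4)))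
            (P (2 ^ t * (4 * u + 2))) := by
          have := (h (t + 1) u (u + 1) u (by omega)).1
          have f0 : 2 ^ (t + 1 + 1) * u = 2 ^ t * (4 * u) := by ring
          have f1 : 2 ^ (t + 1 + 1) * (u + 1) = 2 ^ t * (4 * u + 4) := by ring
          rw [f0, f1, e1] at this
          refine this ⟨by positivity, hu4.trans (hu2.trans_lt hjlt)⟩
            ⟨by positivity, hu2.trans_lt hjlt⟩ ⟨by positivity, lt_of_le_of_lt ?_
              (hu2.trans_lt hjlt)⟩
          gcongr; omega
        exact div_nonneg hc.le hw0.le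
      have h1 : 2 ^ s * H ≤ 2 * d := by
        have : (2 ^ s * H) * ((P (2 ^ t * (4 * u + 4))).1 - (P (2 ^ t * (4 * u))).1) ≤
            (2 * d) * ((P (2 ^ t * (4 * u + 4))).1 - (P (2 ^ t * (4 * u))).1) := by
          nlinarith [mul_le_mul_of_nonneg_right hw hH]
        exact le_of_mul_le_mul_right this hw0
      rw [Finset.sum_range_succ, pow_add, pow_succ]
      have h3 := mul_le_mul_of_nonneg_left hh (by positivity : (0 : ℝ) ≤ 2 ^ s)
      have h4 := mul_le_mul_of_nonneg_left h1 (by positivity : (0 : ℝ) ≤ 2 ^ s)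
      linarith
    -- Keep the half that is no wider than the other; the height estimate holds for both.
    by_cases hhalf : 2 * ((P (2 ^ t * (4 * u + 2))).1 - (P (2 ^ t * (4 * u))).1) ≤
        (P (2 ^ t * (4 * u + 4))).1 - (P (2 ^ t * (4 * u))).1
    · refine ⟨2 * u, ?_, ?_, ?_, ?_⟩
      · rw [← mul_assoc 2 2 u]; exact hu1
      · exact le_trans (Nat.mul_le_mul_left _ (by omega)) hu2
      · have e : 2 * (2 * u) = 4 * u := by ring
        rw [e, pow_succ]
        nlinarith [mul_le_mul_of_nonneg_left hhalf (by positivity : (0 : ℝ) ≤ 2 ^ s)]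
      · have e : 2 * (2 * u) = 4 * u := by ring
        rw [e]
        exact grow _ g1
    · refine ⟨2 * u + 1, ?_, ?_, ?_, ?_⟩
      · exact hu1.trans (Nat.mul_le_mul_left _ (by omega))
      · refine le_trans (le_of_eq ?_) hu2
        ring
      · have e : 2 * (2 * u + 1) = 4 * u + 2 := by ring
        rw [e, pow_succ]
        have h2s' : (0 : ℝ) ≤ 2 ^ s := by positivity
        nlinarith [mul_le_mul_of_nonneg_left (not_le.1 hhalf).le h2s']
      · have e : 2 * (2 * u + 1) = 4 * u + 2 := by ring
        rw [e]
        exact grow _ g2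

/-! ### A starting block with room on both sides. -/

/-- In an increasing sequence whose gaps have bounded ratio, some gap is at most the distances
to both ends of the sequence. -/
theorem exists_gap_le {X : ℕ → ℝ} {n : ℕ} {R : ℝ} (hR0 : 0 ≤ R)
    (hX : StrictMonoOn X (Set.Icc 1 (n + 3)))
    (hR : ∀ i ∈ Set.Icc 1 (n + 3), ∀ j ∈ Set.Icc 1 (n + 3), ∀ i' ∈ Set.Icc 1 (n + 3),
      ∀ j' ∈ Set.Icc 1 (n + 3), i < j → i' < j' → X j - X i ≤ R * (X j' - X i'))
    (hn : R ^ 2 < 2 ^ n) :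
    ∃ j, 2 ≤ j ∧ j + 1 ≤ n + 3 ∧ X (j + 1) - X j ≤ X j - X 1 ∧
      X (j + 1) - X j ≤ X (n + 3) - X (j + 1) := by
  by_contra hcon
  push Not at hcon
  have hlt : ∀ i j, 1 ≤ i → i < j → j ≤ n + 3 → X i < X j := fun i j h1 h2 h3 =>
    hX ⟨h1, by omega⟩ ⟨by omega, h3⟩ h2
  -- The ratio of the distances from `X (s + 2)` to the two ends at least doubles with each step: a
  -- gap larger than the left distance doubles that distance, and any other gap, by assumption,
  -- exceeds the remaining right distance and so at least halves it.
  have main : ∀ s ≤ n, 2 ^ s * ((X 2 - X 1) * (X (n + 3) - X (s + 2))) ≤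
      (X (s + 2) - X 1) * (X (n + 3) - X 2) := by
    intro s
    induction s with
    | zero => intro _; simp
    | succ s ih =>
      intro hs
      have ih := ih (by omega)
      have l1 := hlt 1 2 (by omega) (by omega) (by omega)
      have l2 := hlt 2 (n + 3) (by omega) (by omega) (by omega)
      have l3 := hlt (s + 2) (s + 3) (by omega) (by omega) (by omega)
      have l4 := hlt (s + 3) (n + 3) (by omega) (by omega) (by omega)
      have l5 := hlt 1 (s + 2) (by omega) (by omega) (by omega)
      have e : s + 1 + 2 = s + 3 := by ring
      rw [e, pow_succ]
      have hs2 : (0 : ℝ) < 2 ^ s * (X 2 - X 1) := by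
        have := sub_pos.2 l1; positivity
      rcases le_or_gt (X (s + 3) - X (s + 2)) (X (s + 2) - X 1) with hc | hc
      · have hc' := hcon (s + 2) (by omega) (by omega) hc
        have e' : s + 2 + 1 = s + 3 := by ring
        rw [e'] at hc'
        have h1 : 2 * (X (n + 3) - X (s + 3)) ≤ X (n + 3) - X (s + 2) := by linarith
        have h2 := mul_le_mul_of_nonneg_left h1 hs2.le
        have h3 : (X (s + 2) - X 1) * (X (n + 3) - X 2) ≤ (X (s + 3) - X 1) * (X (n + 3) - X 2) :=
          mul_le_mul_of_nonneg_right (by linarith) (by linarith)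
        linarith
      · have h1 : 2 * (X (s + 2) - X 1) ≤ X (s + 3) - X 1 := by linarith
        have h2 := mul_le_mul_of_nonneg_right h1 (by linarith : 0 ≤ X (n + 3) - X 2)
        have h3 := mul_le_mul_of_nonneg_left
          (by linarith : X (n + 3) - X (s + 3) ≤ X (n + 3) - X (s + 2)) hs2.le
        linarith
  have hfin := main n le_rfl
  have l1 := sub_pos.2 (hlt 1 2 (by omega) (by omega) (by omega))
  have l2 := sub_pos.2 (hlt (n + 2) (n + 3) (by omega) (by omega) (by omega))
  have l3 := sub_pos.2 (hlt 2 (n + 3) (by omega) (by omega) (by omega))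
  -- Two comparisons of gaps bound the total growth of that ratio by R², against 2^n from doubling.
  have r1 := hR 1 ⟨by omega, by omega⟩ (n + 2) ⟨by omega, by omega⟩ 1 ⟨by omega, by omega⟩ 2
    ⟨by omega, by omega⟩ (by omega) (by omega)
  have r2 := hR 2 ⟨by omega, by omega⟩ (n + 3) ⟨by omega, by omega⟩ (n + 2) ⟨by omega, by omega⟩
    (n + 3) ⟨by omega, by omega⟩ (by omega) (by omega)
  have h1 := mul_le_mul r1 r2 l3.le (by positivity)
  have h2 : 2 ^ n * ((X 2 - X 1) * (X (n + 3) - X (n + 2))) ≤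
      R ^ 2 * ((X 2 - X 1) * (X (n + 3) - X (n + 2))) := by
    linarith
  exact absurd (le_of_mul_le_mul_right h2 (mul_pos l1 l2)) (not_le.2 hn)

/-- A chain of many points whose horizontal gaps have ratios at most `R` has two heights whose
ratio is large, unless `R` is huge. -/
theorem HighChain.two_pow_le {n T : ℕ} {P : ℕ → ℝ × ℝ} {R : ℝ} (hR0 : 0 ≤ R)
    (h : HighChain (Set.Ioo 0 (2 ^ (T + 1) * (n + 4))) P)
    (hmono : StrictMonoOn (fun i => (P i).1) (Set.Ioo 0 (2 ^ (T + 1) * (n + 4))))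
    (hR : ∀ i j i' j', 0 < i → i < j → j < 2 ^ (T + 1) * (n + 4) → 0 < i' → i' < j' →
      j' < 2 ^ (T + 1) * (n + 4) → (P j).1 - (P i).1 ≤ R * ((P j').1 - (P i').1))
    (hH : ∀ i j l i' j' l', 0 < i → i < l → l < j → j < 2 ^ (T + 1) * (n + 4) → 0 < i' →
      i' < l' → l' < j' → j' < 2 ^ (T + 1) * (n + 4) → 0 < cross (P i) (P j) (P l) →
      0 < cross (P i') (P j') (P l') →
      height (P i) (P j) (P l) ≤ R * height (P i') (P j') (P l'))
    (hn : R ^ 2 < 2 ^ n) :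
    2 ^ (∑ i ∈ Finset.range T, i) ≤ 2 ^ T * R := by
  have h2T : 0 < 2 ^ (T + 1) := by positivity
  have hIcc : ∀ i ∈ Set.Icc 1 (n + 3), 0 < 2 ^ (T + 1) * i ∧
      2 ^ (T + 1) * i < 2 ^ (T + 1) * (n + 4) := fun i hi =>
    ⟨Nat.mul_pos h2T hi.1, (mul_lt_mul_iff_right₀ h2T).2 (by have := hi.2; omega)⟩
  obtain ⟨j, hj, hjn, hL, hRt⟩ := exists_gap_le (X := fun i => (P (2 ^ (T + 1) * i)).1) hR0
    (fun a ha b hb hab => hmono (hIcc a ha) (hIcc b hb) ((mul_lt_mul_iff_right₀ h2T).2 hab))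
    (fun i hi j hj i' hi' j' hj' hij hij' => hR _ _ _ _ (hIcc i hi).1
      ((mul_lt_mul_iff_right₀ h2T).2 hij) (hIcc j hj).2 (hIcc i' hi').1
      ((mul_lt_mul_iff_right₀ h2T).2 hij') (hIcc j' hj').2) hn
  rw [mul_one] at hL
  obtain ⟨u, hu1, hu2, -, hh⟩ := HighChain.exists_height_ge (n := n + 3) h hmono hj hjn hL hRt T 0
    (by omega)
  have hj0 : 0 < 2 ^ T * (2 * j) := by positivity
  have hj1 : 2 ^ T * (2 * j) < 2 ^ T * (2 * j + 1) := by gcongr; omega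
  have hj2 : 2 ^ T * (2 * j + 1) < 2 ^ T * (2 * j + 2) := by gcongr; omega
  have hj3 : 2 ^ T * (2 * j + 2) < 2 ^ (T + 1) * (n + 4) := by
    have : 2 ^ T * (2 * j + 2) = 2 ^ (T + 1) * (j + 1) := by ring
    rw [this]; gcongr; omega
  have hjc : 2 ^ (T + 1) * (j + 1) < 2 ^ (T + 1) * (n + 4) := by gcongr; omega
  have hcross : ∀ t v, 0 < 2 ^ t * (2 * v) → 2 ^ t * (2 * v + 2) < 2 ^ (T + 1) * (n + 4) →
      0 < cross (P (2 ^ t * (2 * v))) (P (2 ^ t * (2 * v + 2))) (P (2 ^ t * (2 * v + 1))) := by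
    intro t v h0 h1
    have := (h t v (v + 1) v (by omega)).1
    have e0 : 2 ^ (t + 1) * v = 2 ^ t * (2 * v) := by ring
    have e1 : 2 ^ (t + 1) * (v + 1) = 2 ^ t * (2 * v + 2) := by ring
    rw [e0, e1] at this
    have o1 : 2 ^ t * (2 * v) < 2 ^ t * (2 * v + 1) := by gcongr; omega
    have o2 : 2 ^ t * (2 * v + 1) < 2 ^ t * (2 * v + 2) := by gcongr; omega
    exact this ⟨h0, o1.trans (o2.trans h1)⟩ ⟨h0.trans (o1.trans o2), h1⟩ ⟨h0.trans o1, o2.trans h1⟩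
  have hu0 : 0 < 2 ^ 0 * (2 * u) := lt_of_lt_of_le (by positivity) hu1
  have hu3 := hu2.trans_lt hjc
  have c1 := hcross 0 u hu0 hu3
  have c2 := hcross T j hj0 hj3
  have hle := hH _ _ _ _ _ _ hu0 (by gcongr; omega) (by gcongr; omega) hu3 hj0 hj1 hj2 hj3 c1 c2
  have hpos : 0 < height (P (2 ^ T * (2 * j))) (P (2 ^ T * (2 * j + 2))) (P (2 ^ T * (2 * j + 1))) :=
    div_pos c2 (sub_pos.2 (hmono ⟨hj0, hj1.trans (hj2.trans hj3)⟩
      ⟨hj0.trans (hj1.trans hj2), hj3⟩ (hj1.trans hj2)))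
  have h1 := mul_le_mul_of_nonneg_left hle (by positivity : (0 : ℝ) ≤ 2 ^ T)
  have h2 := hh.trans h1
  exact le_of_mul_le_mul_right (h2.trans_eq (mul_assoc _ _ _).symm) hpos

/-! ### Projective normalisation. -/

/-- The projective map sending `b` to the vertical point at infinity and the line `b a` to the line
at infinity. -/
def proj (b a r : ℝ × ℝ) : ℝ × ℝ :=
  (-((a.1 - b.1) * (r.1 - b.1) + (a.2 - b.2) * (r.2 - b.2)) / cross b a r, 1 / cross b a r)

/-- On the side of the line `b a` where `cross b a` is positive, angular order around `b` becomes
order by x-coordinate. -/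
theorem proj_fst_sub {b a p q : ℝ × ℝ} (hp : cross b a p ≠ 0) (hq : cross b a q ≠ 0) :
    (proj b a q).1 - (proj b a p).1 = ((a.1 - b.1) ^ 2 + (a.2 - b.2) ^ 2) * cross b p q /
      (cross b a p * cross b a q) := by
  unfold proj
  field_simp
  unfold cross
  ring

theorem cross_proj {b a p q r : ℝ × ℝ} (hp : cross b a p ≠ 0) (hq : cross b a q ≠ 0)
    (hr : cross b a r ≠ 0) :
    cross (proj b a p) (proj b a q) (proj b a r) =
      ((a.1 - b.1) ^ 2 + (a.2 - b.2) ^ 2) * cross p q r /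
        (cross b a p * cross b a q * cross b a r) := by
  have : cross (proj b a p) (proj b a q) (proj b a r) =
      ((proj b a q).1 - (proj b a p).1) * (1 / cross b a r - 1 / cross b a p) -
        (1 / cross b a q - 1 / cross b a p) * ((proj b a r).1 - (proj b a p).1) := rfl
  rw [this, proj_fst_sub hp hq, proj_fst_sub hp hr]
  field_simp
  unfold cross
  ring

theorem sq_add_sq_pos_of_cross_ne_zero {b a p : ℝ × ℝ} (hp : cross b a p ≠ 0) :
    0 < (a.1 - b.1) ^ 2 + (a.2 - b.2) ^ 2 := by
  by_contra h
  have h1 : a.1 - b.1 = 0 := by nlinarith [sq_nonneg (a.1 - b.1), sq_nonneg (a.2 - b.2)]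
  have h2 : a.2 - b.2 = 0 := by nlinarith [sq_nonneg (a.1 - b.1), sq_nonneg (a.2 - b.2)]
  exact hp (by simp [cross, h1, h2])

/-- The squared length of `b a` cancels, leaving only determinants of the original points, which are
integers for a drawing. -/
theorem height_proj {b a p q r : ℝ × ℝ} (hp : cross b a p ≠ 0) (hq : cross b a q ≠ 0)
    (hr : cross b a r ≠ 0) :
    height (proj b a p) (proj b a q) (proj b a r) =
      cross p q r / (cross b p q * cross b a r) := by
  have := (sq_add_sq_pos_of_cross_ne_zero hp).ne'
  rw [height, cross_proj hp hq hr, proj_fst_sub hp hq]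
  rcases eq_or_ne (cross b p q) 0 with h | h
  · simp [h]
  · field_simp

/-! ### Integer determinants and the bound on ratios. -/

theorem one_le_cross_toPlane {p q r : ℤ × ℤ} (h : 0 < cross (toPlane p) (toPlane q) (toPlane r)) :
    1 ≤ cross (toPlane p) (toPlane q) (toPlane r) := by
  have e : cross (toPlane p) (toPlane q) (toPlane r) =
      (((q.1 - p.1) * (r.2 - p.2) - (q.2 - p.2) * (r.1 - p.1) : ℤ) : ℝ) := by
    simp [cross, toPlane]
  rw [e] at h ⊢
  exact_mod_cast h

theorem abs_le_size {D : Finset (ℤ × ℤ)} {p : ℤ × ℤ} (hp : p ∈ D) :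
    |(toPlane p).1| ≤ size D ∧ |(toPlane p).2| ≤ size D := by
  have h : max p.1.natAbs p.2.natAbs ≤ size D :=
    Finset.le_sup (f := fun p : ℤ × ℤ => max p.1.natAbs p.2.natAbs) hp
  have e : ∀ a : ℤ, |(a : ℝ)| = (a.natAbs : ℝ) := fun a => by
    rw [Nat.cast_natAbs, Int.cast_abs]
  simp only [toPlane, e]
  exact ⟨by exact_mod_cast (le_max_left _ _).trans h, by exact_mod_cast (le_max_right _ _).trans h⟩

theorem cross_le_size {D : Finset (ℤ × ℤ)} {p q r : ℤ × ℤ} (hp : p ∈ D) (hq : q ∈ D)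
    (hr : r ∈ D) : cross (toPlane p) (toPlane q) (toPlane r) ≤ 8 * (size D : ℝ) ^ 2 := by
  obtain ⟨p1, p2⟩ := abs_le_size hp
  obtain ⟨q1, q2⟩ := abs_le_size hq
  obtain ⟨r1, r2⟩ := abs_le_size hr
  have hs : ∀ a b : ℝ, |a| ≤ size D → |b| ≤ size D → |a - b| ≤ 2 * size D := fun a b ha hb =>
    (abs_sub a b).trans (by linarith)
  have hm : ∀ a b : ℝ, |a| ≤ 2 * size D → |b| ≤ 2 * size D → |a * b| ≤ 4 * (size D : ℝ) ^ 2 :=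
    fun a b ha hb => by
      rw [abs_mul]
      calc |a| * |b| ≤ (2 * size D) * (2 * size D) :=
            mul_le_mul ha hb (abs_nonneg _) (by positivity)
        _ = 4 * (size D : ℝ) ^ 2 := by ring
  have h1 := (abs_le.1 (hm _ _ (hs _ _ q1 p1) (hs _ _ r2 p2))).2
  have h2 := (abs_le.1 (hm _ _ (hs _ _ q2 p2) (hs _ _ r1 p1))).1
  unfold cross
  linarith

/-- Gaps and heights both have this shape after projection. The left quotient is at most C and the
right one at least 1 / C², hence the cube. -/
theorem div_mul_le_mul_div_mul {C a b c a' b' c' : ℝ} (ha1 : 0 < a) (hb1 : 1 ≤ b) (hc1 : 1 ≤ c)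
    (ha1' : 1 ≤ a') (hb1' : 0 < b') (hc1' : 0 < c') (ha : a ≤ C) (hb : b' ≤ C) (hc : c' ≤ C) :
    a / (b * c) ≤ C ^ 3 * (a' / (b' * c')) := by
  have hC : 0 < C := ha1.trans_le ha
  have h1 : a / (b * c) ≤ C := (div_le_self ha1.le (by nlinarith)).trans ha
  have h2 : 1 / (C * C) ≤ a' / (b' * c') :=
    div_le_div₀ (by linarith) ha1' (by positivity) (mul_le_mul hb hc hc1'.le hC.le)
  calc a / (b * c) ≤ C := h1
    _ = C ^ 3 * (1 / (C * C)) := by field_simp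
    _ ≤ C ^ 3 * (a' / (b' * c')) := mul_le_mul_of_nonneg_left h2 (by positivity)

/-- The size `M` of an integer drawing of a chain of `2 ^ (T + 2) * (n + 4)` points satisfies
`2 ^ (T * (T - 3) / 2) ≤ 512 * M ^ 6`, unless it is huge. -/
theorem HighChain.two_pow_le_size {D : Finset (ℤ × ℤ)} {n T : ℕ} {z : ℕ → ℤ × ℤ}
    (hz : ∀ i < 2 * (2 ^ (T + 1) * (n + 4)), z i ∈ D)
    (h : HighChain (Set.Iio (2 * (2 ^ (T + 1) * (n + 4)))) fun i => toPlane (z i))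
    (hn : ((8 * (size D : ℝ) ^ 2) ^ 3) ^ 2 < 2 ^ n) :
    2 ^ (∑ i ∈ Finset.range T, i) ≤ 2 ^ T * (8 * (size D : ℝ) ^ 2) ^ 3 := by
  set K := 2 ^ (T + 1) * (n + 4) with hK
  have hK1 : 1 ≤ K := Nat.mul_pos (by positivity) (by omega)
  have zb : z 1 ∈ D := hz 1 (by omega)
  have za : z 0 ∈ D := hz 0 (by omega)
  set b := toPlane (z 1) with hb
  set a := toPlane (z 0) with ha
  -- `Z 0` is `a`, which `proj` sends to infinity, so only positive indices below K are projected.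
  let Z : ℕ → ℝ × ℝ := fun i => toPlane (z (2 * i))
  have hb_above : ∀ i j, i < j → j < K → 0 < cross b (Z i) (Z j) := by
    intro i j hij hj
    have := (h 0 i j 0 hij).1
    simp only [zero_add, pow_one, pow_zero, one_mul, mul_zero, Set.mem_Iio] at this
    have := this (by omega) (by omega) (by omega)
    rwa [cross_cyclic, cross_cyclic] at this
  have hZpos : ∀ i, 0 < i → i < K → 0 < cross b a (Z i) := fun i hi hiK => hb_above 0 i hi hiK
  have hZchain : HighChain (Set.Iio K) Z := by
    have := h.comp_two_pow 1
    refine HighChain.mono (I := {i | 2 ^ 1 * i ∈ Set.Iio (2 * K)}) ?_ ?_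
    · simpa only [pow_one] using this
    · intro i hi
      simp only [Set.mem_Iio, Set.mem_ofPred_eq, pow_one] at hi ⊢
      omega
  have hN : ∀ {i}, 0 < i → i < K → 0 < (a.1 - b.1) ^ 2 + (a.2 - b.2) ^ 2 := fun hi hiK =>
    sq_add_sq_pos_of_cross_ne_zero (hZpos _ hi hiK).ne'
  have hsub : ∀ i j, 0 < i → i < j → j < K → (proj b a (Z j)).1 - (proj b a (Z i)).1 =
      ((a.1 - b.1) ^ 2 + (a.2 - b.2) ^ 2) *
        (cross b (Z i) (Z j) / (cross b a (Z i) * cross b a (Z j))) := fun i j hi hij hj => by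
    rw [proj_fst_sub (hZpos i hi (hij.trans hj)).ne' (hZpos j (hi.trans hij) hj).ne',
      mul_div_assoc]
  have hmem : ∀ i, i < K → z (2 * i) ∈ D := fun i hi => hz _ (by omega)
  have hwle : ∀ i j, i < K → j < K → cross b (Z i) (Z j) ≤ 8 * (size D : ℝ) ^ 2 :=
    fun i j hi hj => cross_le_size zb (hmem i hi) (hmem j hj)
  have hZle : ∀ i, i < K → cross b a (Z i) ≤ 8 * (size D : ℝ) ^ 2 :=
    fun i hi => cross_le_size zb za (hmem i hi)
  have hw1 : ∀ i j, i < j → j < K → 1 ≤ cross b (Z i) (Z j) := fun i j hij hj =>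
    one_le_cross_toPlane (hb_above i j hij hj)
  have hZ1 : ∀ i, 0 < i → i < K → 1 ≤ cross b a (Z i) := fun i hi hiK =>
    one_le_cross_toPlane (hZpos i hi hiK)
  have hfac : ∀ i j l, i ∈ Set.Ioo 0 K → j ∈ Set.Ioo 0 K → l ∈ Set.Ioo 0 K → ∃ c, 0 < c ∧
      cross (proj b a (Z i)) (proj b a (Z j)) (proj b a (Z l)) =
        c * cross (Z i) (Z j) (Z l) := by
    intro i j l hi hj hl
    have pi := hZpos i hi.1 hi.2
    have pj := hZpos j hj.1 hj.2
    have pl := hZpos l hl.1 hl.2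
    have pN := hN hi.1 hi.2
    refine ⟨((a.1 - b.1) ^ 2 + (a.2 - b.2) ^ 2) /
      (cross b a (Z i) * cross b a (Z j) * cross b a (Z l)), by positivity, ?_⟩
    rw [cross_proj pi.ne' pj.ne' pl.ne']
    ring
  refine HighChain.two_pow_le (P := fun i => proj b a (Z i)) (by positivity) ?_ ?_ ?_ ?_ hn
  · intro t u v w huv
    obtain ⟨h1, h2⟩ := hZchain t u v w huv
    refine ⟨fun hu hv hw => ?_, fun hu hv hw => ?_⟩
    · obtain ⟨c, hc, e⟩ := hfac _ _ _ hu hv hw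
      rw [e]
      exact mul_pos hc (h1 hu.2 hv.2 hw.2)
    · obtain ⟨c, hc, e⟩ := hfac _ _ _ hu hv hw
      rw [e]
      exact mul_neg_of_pos_of_neg hc (h2 hu.2 hv.2 hw.2)
  · intro i hi j hj hij
    have pi := hZpos i hi.1 hi.2
    have pj := hZpos j hj.1 hj.2
    have pN := hN hi.1 hi.2
    have pw := hb_above i j hij hj.2
    have := hsub i j hi.1 hij hj.2
    rw [← sub_pos, this]
    positivity
  · intro i j i' j' hi hij hj hi' hij' hj'
    -- Gaps share the squared length of `b a` as a factor, so it does not affect their ratio.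
    rw [hsub i j hi hij hj, hsub i' j' hi' hij' hj', mul_left_comm]
    refine mul_le_mul_of_nonneg_left ?_ (hN hi (hij.trans hj)).le
    exact div_mul_le_mul_div_mul (hb_above i j hij hj) (hZ1 i hi (hij.trans hj))
      (hZ1 j (hi.trans hij) hj) (hw1 i' j' hij' hj') (hZpos i' hi' (hij'.trans hj'))
      (hZpos j' (hi'.trans hij') hj') (hwle i j (hij.trans hj) hj) (hZle i' (hij'.trans hj'))
      (hZle j' hj')
  · intro i j l i' j' l' hi hil hlj hj hi' hil' hlj' hj' hc hc'
    have kl := hlj.trans hj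
    have ki := hil.trans kl
    have kl' := hlj'.trans hj'
    have ki' := hil'.trans kl'
    have pos_of : ∀ i j l, i ∈ Set.Ioo 0 K → j ∈ Set.Ioo 0 K → l ∈ Set.Ioo 0 K →
        0 < cross (proj b a (Z i)) (proj b a (Z j)) (proj b a (Z l)) →
        0 < cross (Z i) (Z j) (Z l) := by
      intro i j l hi hj hl hc
      obtain ⟨c, hc0, e⟩ := hfac i j l hi hj hl
      rw [e] at hc
      exact pos_of_mul_pos_right hc hc0.le
    have q := pos_of i j l ⟨hi, ki⟩ ⟨hi.trans (hil.trans hlj), hj⟩ ⟨hi.trans hil, kl⟩ hc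
    have q' := pos_of i' j' l' ⟨hi', ki'⟩ ⟨hi'.trans (hil'.trans hlj'), hj'⟩
      ⟨hi'.trans hil', kl'⟩ hc'
    rw [height_proj (hZpos i hi ki).ne' (hZpos j (hi.trans (hil.trans hlj)) hj).ne'
        (hZpos l (hi.trans hil) kl).ne',
      height_proj (hZpos i' hi' ki').ne' (hZpos j' (hi'.trans (hil'.trans hlj')) hj').ne'
        (hZpos l' (hi'.trans hil') kl').ne']
    exact div_mul_le_mul_div_mul q (hw1 i j (hil.trans hlj) hj)
      (hZ1 l (hi.trans hil) kl) (one_le_cross_toPlane q')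
      (hb_above i' j' (hil'.trans hlj') hj') (hZpos l' (hi'.trans hil') kl')
      (cross_le_size (hmem i ki) (hmem j hj) (hmem l kl))
      (hwle i' j' ki' hj') (hZle l' kl')

/-! ### Choice of parameters and conclusion. -/

/-- The left side is 2 * (4 * j ^ 2 + 5 * j + 2) + 4: twice the target exponent, for R² instead of
R, plus the 4 of n + 4. -/
theorem eight_mul_sq_add_le_two_pow (j : ℕ) (hj : 20 ≤ j) :
    8 * j ^ 2 + 10 * j + 8 ≤ 2 ^ (j - 3) := by
  induction j, hj using Nat.le_induction with
  | base => norm_num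
  | succ j hj ih =>
    have e : j + 1 - 3 = (j - 3) + 1 := by omega
    rw [e, pow_succ 2 (j - 3)]
    nlinarith

/-- The size of a drawing of a Horton set of `2 ^ k` points, for large `k`. -/
theorem IsHorton.two_pow_le_size {k : ℕ} (hk : 83 ≤ k) {H : Finset (ℝ × ℝ)} (h : IsHorton k H)
    {D : Finset (ℤ × ℤ)} (hD : IsDrawing D H) :
    (2 : ℝ) ^ ((k : ℝ) * (k - 1) / 4) ≤ (8 * (size D : ℝ) ^ 2) ^ 3 := by
  obtain ⟨z, hz, hch⟩ := h.exists_highChain_of_isDrawing hD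
  -- The parameters are T = 3 * j and n + 4 = 2 ^ (j + r - 2). About three quarters of the levels go
  -- to halving, since (3j)² / 2 exceeds the required k² / 4, about 4j²; the rest make 2^n doubly
  -- exponential.
  obtain ⟨j, r, hr, rfl⟩ : ∃ j r, r < 4 ∧ k = 4 * j + r :=
    ⟨k / 4, k % 4, Nat.mod_lt _ (by norm_num), by omega⟩
  have hj : 20 ≤ j := by omega
  have hpow := eight_mul_sq_add_le_two_pow j hj
  obtain ⟨n, hn⟩ : ∃ n, 2 ^ (j + r - 2) = n + 4 := by
    have h1 : 2 ^ (j - 3) ≤ 2 ^ (j + r - 2) := Nat.pow_le_pow_right (by norm_num) (by omega)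
    exact ⟨2 ^ (j + r - 2) - 4, by omega⟩
  have hcard : 2 ^ (4 * j + r) = 2 * (2 ^ (3 * j + 1) * (n + 4)) := by
    rw [← hn, ← pow_add, ← pow_succ']
    congr 1
    omega
  rw [hcard] at hz hch
  set R := (8 * (size D : ℝ) ^ 2) ^ 3 with hR
  have hR0 : 0 ≤ R := by positivity
  have hexp : ((4 * j + r : ℕ) : ℝ) * ((4 * j + r : ℕ) - 1) / 4 ≤ ((4 * j ^ 2 + 5 * j + 2 : ℕ) : ℝ) := by
    push_cast
    have hr' : (r : ℝ) ≤ 3 := by exact_mod_cast Nat.lt_succ_iff.1 hr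
    have hr0 : (0 : ℝ) ≤ r := Nat.cast_nonneg r
    have hj' : (0 : ℝ) ≤ j := Nat.cast_nonneg j
    nlinarith
  have hle : (2 : ℝ) ^ (((4 * j + r : ℕ) : ℝ) * ((4 * j + r : ℕ) - 1) / 4) ≤
      2 ^ (4 * j ^ 2 + 5 * j + 2) := by
    rw [← Real.rpow_natCast]
    exact Real.rpow_le_rpow_of_exponent_le (by norm_num) hexp
  refine hle.trans ?_
  rcases lt_or_ge (R ^ 2) (2 ^ n) with hlt | hge
  · have main := hch.two_pow_le_size hz hlt
    rw [← hR] at main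
    have hsum : 3 * j + (4 * j ^ 2 + 5 * j + 2) ≤ ∑ i ∈ Finset.range (3 * j), i := by
      have h1 := Finset.sum_range_id_mul_two (3 * j)
      have h2 : 3 * j * (3 * j - 1) + 3 * j = 9 * j ^ 2 := by
        obtain ⟨i, rfl⟩ : ∃ i, j = i + 1 := ⟨j - 1, by omega⟩
        have : 3 * (i + 1) - 1 = 3 * i + 2 := by omega
        rw [this]; ring
      nlinarith
    have h1 : (2 : ℝ) ^ (3 * j + (4 * j ^ 2 + 5 * j + 2)) ≤ 2 ^ (∑ i ∈ Finset.range (3 * j), i) :=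
      pow_le_pow_right₀ (by norm_num) hsum
    rw [pow_add] at h1
    exact le_of_mul_le_mul_left (h1.trans main) (by positivity)
  · have h1 : 2 * (4 * j ^ 2 + 5 * j + 2) ≤ n := by
      have h1 : 2 ^ (j - 3) ≤ 2 ^ (j + r - 2) := Nat.pow_le_pow_right (by norm_num) (by omega)
      omega
    have h2 : ((2 : ℝ) ^ (4 * j ^ 2 + 5 * j + 2)) ^ 2 ≤ R ^ 2 := by
      rw [← pow_mul, mul_comm]
      exact (pow_le_pow_right₀ (by norm_num) h1).trans hge
    exact le_of_sq_le_sq h2 hR0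

end

end Horton

theorem theorem3 :
    ∃ c : ℝ, 0 < c ∧ ∃ N : ℕ, ∀ k n : ℕ, n = 2 ^ k → N ≤ n →
      ∀ H : Finset (ℝ × ℝ), Horton.IsHorton k H →
        ∀ D : Finset (ℤ × ℤ), Horton.IsDrawing D H →
          c * (n : ℝ) ^ ((1 / 24 : ℝ) * Real.logb 2 ((n : ℝ) / 2)) ≤ (Horton.size D : ℝ) := by
  -- The constant 1 / 4 works because (8M²)³ = 512 M⁶ ≤ (4M)⁶.
  refine ⟨1 / 4, by norm_num, 2 ^ 83, ?_⟩
  rintro k n rfl hN H hH D hD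
  have hk : 83 ≤ k := (Nat.pow_le_pow_iff_right (by norm_num)).1 hN
  have h := hH.two_pow_le_size hk hD
  have hlog : Real.logb 2 (((2 ^ k : ℕ) : ℝ) / 2) = k - 1 := by
    rw [Real.logb_div (by positivity) (by norm_num)]
    push_cast
    rw [Real.logb_pow]
    simp
  have e : ((2 ^ k : ℕ) : ℝ) ^ ((1 / 24 : ℝ) * Real.logb 2 (((2 ^ k : ℕ) : ℝ) / 2)) =
      (2 : ℝ) ^ ((k : ℝ) * (k - 1) / 24) := by
    rw [hlog]
    push_cast
    rw [← Real.rpow_natCast, ← Real.rpow_mul (by norm_num)]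
    congr 1
    ring
  rw [e]
  have e6 : ((2 : ℝ) ^ ((k : ℝ) * (k - 1) / 24)) ^ 6 = (2 : ℝ) ^ ((k : ℝ) * (k - 1) / 4) := by
    rw [← Real.rpow_natCast, ← Real.rpow_mul (by norm_num)]
    congr 1
    push_cast
    ring
  set M := (Horton.size D : ℝ)
  have hM : 0 ≤ M := Nat.cast_nonneg _
  have h6 : ((2 : ℝ) ^ ((k : ℝ) * (k - 1) / 24)) ^ 6 ≤ (4 * M) ^ 6 := by
    rw [e6]
    refine h.trans ?_
    have : 0 ≤ M ^ 6 := by positivity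
    nlinarith
  have := le_of_pow_le_pow_left₀ (by norm_num) (by positivity) h6
  linarith
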